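/- Let $p$ be a prime and let $k$ be a prime power such that $k+1=2p$ and $3\mid \frac{k-1}{2}$. Let $G=\mathrm{PSL}(2,k)$ and let $H\le G$ be a subgroup isomorphic to a semidirect product $\mathbb{Z}_k\rtimes\mathbb{Z}_{(k-1)/6}$, where $\mathbb{Z}_k$ denotes the additive group of the field with $k$ elements. Let $X$ be a connected generalized orbital graph of the action of $G$ on the set $G/H$ of cosets of $H$; that is, $X$ is a connected simple undirected graph with vertex set $G/H$ whose set of arcs (ordered pairs of adjacent vertices) is a union of orbits of $G$ acting diagonally on $G/H\times G/H$. Then $X$ has a Hamilton cycle. -/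

import Mathlib

/-- The orbitals of a group `G` acting on a set `V`: the orbits of the diagonal action of `G`
on `V × V`. -/
def orbitals (G : Type*) (V : Type*) [Group G] [MulAction G V] : Set (Set (V × V)) :=
  {O | ∃ u v : V, O = MulAction.orbit G (u, v)}

/-- A simple graph `X` on a `G`-set `V` is a generalized orbital graph of the action of `G` on `V`
if its set of arcs (ordered pairs of adjacent vertices) is a union of orbitals.
Since `X` is simple and undirected, this union consists of non-diagonal orbitals and
is closed under pairing. -/
def IsGeneralizedOrbitalGraph (G : Type*) {V : Type*} [Group G] [MulAction G V]
    (X : SimpleGraph V) : Prop :=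
  ∃ S ⊆ orbitals G V, ∀ u v : V, X.Adj u v ↔ ∃ O ∈ S, (u, v) ∈ O

/-- The finite group `H` is a semidirect product `N ⋊ ℤ_n`, where `N` is the additive group of `F`
(an elementary abelian group of order `k` when `F` is the field with `k` elements) and `ℤ_n` is the
cyclic group of order `n`, for some action of `ℤ_n` on `N`. -/
def IsAddSemidirectCyclic (F : Type*) [AddGroup F] (n : ℕ) (H : Type*) [Group H] : Prop :=
  ∃ φ : Multiplicative (ZMod n) →* MulAut (Multiplicative F),
    Nonempty (H ≃* Multiplicative F ⋊[φ] Multiplicative (ZMod n))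

/-! Write `k = 6n + 1` and `c = 2n`, so that `k = 3c + 1`. A subgroup of PSL(2, F) of the given
shape fixes a line of the plane: its preimage in SL(2, F) consists of the matrices scaling some
nonzero `u` by an element of a subgroup `C` of the units, with order `c` and containing -1
(`exists_eigenvector_of_normal`). Cosets of `H` thus correspond to nonzero vectors modulo `C`, and
there are `(k ^ 2 - 1) / c = 9c + 6` of them.

Connectedness forces an edge of `X` between non-parallel vectors, with determinant `δ` say. SL(2, F)
is transitive on pairs of vectors with a given nonzero determinant, so `X` contains all pairs whose
determinant lies in `δC`. It is enough to find a Hamilton cycle in this spanning subgraph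
`wedgeGraph`. It is `(3c + 1)`-regular, and two distinct vertices have at most `c` common
neighbours.

Such a graph expands: Cauchy-Schwarz (`sq_card_le_of_not_adj`) bounds vertex sets with no edges
between them. If a longest cycle misses a vertex, let `D` be a component off the cycle, `B` its
attachment set on the cycle and `R` the rest. As in the Chvátal–Erdős argument, the successors of
`B` together with a vertex of `D` are independent. If `B` is small, expansion makes both `D` and `R`
too large; if `B` is large, so is this independent set. Both are impossible once `4 ≤ c`. -/

namespace SimpleGraph

open Finset

/-! ### A counting inequality for pairs of mutually nonadjacent vertex sets -/

/-- In a `d`-regular graph in which two distinct vertices have at most `c` common neighbours,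
a set `S` and a set `Z` without edges between them cannot both be large. -/
theorem sq_card_le_of_not_adj {V : Type*} [Fintype V] [DecidableEq V] (G : SimpleGraph V)
    [DecidableRel G.Adj] {d c : ℕ} (hdeg : ∀ s, #{w | G.Adj w s} = d)
    (hcom : ∀ s t, s ≠ t → #{w | G.Adj w s ∧ G.Adj w t} ≤ c) (S Z : Finset V)
    (hSZ : ∀ s ∈ S, ∀ z ∈ Z, ¬ G.Adj s z) :
    (d * #S) ^ 2 ≤ #Zᶜ * (#S * (d + (#S - 1) * c)) := by
  let e : V → V → ℕ := fun w s => if G.Adj w s then 1 else 0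
  -- Every neighbour of `S` lies outside `Z`, so summing over `Zᶜ` loses no edge.
  have h1 : ∑ w ∈ Zᶜ, ∑ s ∈ S, e w s = d * #S := by
    have : ∑ w ∈ Zᶜ, ∑ s ∈ S, e w s = ∑ w, ∑ s ∈ S, e w s := by
      refine Finset.sum_subset (subset_univ _) fun w _ hw => ?_
      refine Finset.sum_eq_zero fun s hs => ?_
      have hw' : w ∈ Z := by simpa using hw
      simp only [e]
      rw [if_neg fun h => hSZ s hs w hw' h.symm]
    rw [this, Finset.sum_comm, Finset.sum_congr rfl (g := fun _ => d), sum_const, smul_eq_mul,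
      mul_comm]
    intro s _
    rw [← hdeg s, Finset.card_filter]
  -- The squares count common neighbours of ordered pairs from `S`: `d` on the diagonal, at most `c`
  -- off it.
  have h2 : ∑ w ∈ Zᶜ, (∑ s ∈ S, e w s) ^ 2 ≤ #S * (d + (#S - 1) * c) := by
    calc ∑ w ∈ Zᶜ, (∑ s ∈ S, e w s) ^ 2 ≤ ∑ w, (∑ s ∈ S, e w s) ^ 2 :=
          Finset.sum_le_sum_of_subset (subset_univ _)
      _ = ∑ s ∈ S, ∑ t ∈ S, ∑ w, e w s * e w t := by
          simp_rw [sq, Finset.sum_mul_sum]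
          rw [Finset.sum_comm]
          exact Finset.sum_congr rfl fun s _ => Finset.sum_comm
      _ ≤ ∑ s ∈ S, (d + (#S - 1) * c) := by
          refine Finset.sum_le_sum fun s hs => ?_
          rw [← Finset.add_sum_erase S _ hs, ← Finset.card_erase_of_mem hs]
          refine add_le_add ?_ ?_
          · rw [← hdeg s, Finset.card_filter]
            refine Finset.sum_le_sum fun w _ => ?_
            simp only [e]; split_ifs <;> simp
          · rw [← smul_eq_mul, ← Finset.sum_const]
            refine Finset.sum_le_sum fun t ht => ?_
            refine le_trans ?_ (hcom s t (Finset.ne_of_mem_erase ht).symm)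
            rw [Finset.card_filter]
            refine Finset.sum_le_sum fun w _ => ?_
            simp only [e]; split_ifs <;> simp_all
      _ = _ := by rw [sum_const, smul_eq_mul]
  calc (d * #S) ^ 2 = (∑ w ∈ Zᶜ, ∑ s ∈ S, e w s) ^ 2 := by rw [h1]
    _ ≤ #Zᶜ * ∑ w ∈ Zᶜ, (∑ s ∈ S, e w s) ^ 2 := sq_sum_le_card_mul_sum_sq
    _ ≤ _ := Nat.mul_le_mul_left _ h2

/-- The numerical form of `sq_card_le_of_not_adj` for a vertex set of size `x` whose boundary has
size `b < 2c`. -/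
theorem lt_of_expansion {c x b : ℕ} (hc : 4 ≤ c) (hx : 1 ≤ x) (hb : b + 1 ≤ 2 * c)
    (h : ((3 * c + 1) * x) ^ 2 ≤ (x + b) * (x * (3 * c + 1 + (x - 1) * c))) : 7 * c + 4 < x := by
  obtain ⟨y, rfl⟩ := Nat.exists_eq_add_of_le' hx
  rw [Nat.add_sub_cancel] at h
  by_contra! hlt
  have h1 : (3 * c + 1) ^ 2 * (y + 1) ≤ (y + 1 + b) * (3 * c + 1 + y * c) := by
    refine le_of_mul_le_mul_left (a := y + 1) ?_ (Nat.succ_pos _)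
    calc _ = _ := by ring
      _ ≤ _ := h
      _ = _ := by ring
  have h2 : (3 * c + 1) ^ 2 * (y + 1) ≤ (y + 2 * c) * (3 * c + 1 + y * c) :=
    h1.trans (Nat.mul_le_mul_right _ (by omega))
  zify at h2 hlt hc
  have hy : (0 : ℤ) ≤ y := Int.natCast_nonneg _
  -- In `h2`, left minus right equals `c * y * (7 * c + 3 - y) + 3 * c ^ 2 + 4 * c + 1`, hence the
  -- threshold for `x = y + 1`.
  have hcy : 0 ≤ (c : ℤ) * y * (7 * c + 3 - y) :=
    mul_nonneg (mul_nonneg (by linarith) hy) (by linarith)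
  nlinarith

/-- Here `d`, `b`, `r` are the sizes of `D`, `B`, `R`. A small `b` makes `d` and `r` each exceed `7c
+ 4`, more than `9c + 6` in total; a large `b` contradicts `i3`, the bound for an independent set of
size `b + 1`. -/
theorem absurd_of_expansion {c d r b : ℕ} (hc : 4 ≤ c) (hd : 1 ≤ d) (hr : 1 ≤ r)
    (hn : d + b + r = 9 * c + 6)
    (i1 : ((3 * c + 1) * d) ^ 2 ≤ (d + b) * (d * (3 * c + 1 + (d - 1) * c)))
    (i2 : ((3 * c + 1) * r) ^ 2 ≤ (r + b) * (r * (3 * c + 1 + (r - 1) * c)))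
    (i3 : ((3 * c + 1) * (b + 1)) ^ 2 ≤
      (9 * c + 6 - (b + 1)) * ((b + 1) * (3 * c + 1 + (b + 1 - 1) * c))) : False := by
  by_cases hb : b + 1 ≤ 2 * c
  · have := lt_of_expansion hc hd hb i1
    have := lt_of_expansion hc hr hb i2
    omega
  rw [Nat.add_sub_cancel] at i3
  have h1 : (3 * c + 1) ^ 2 * (b + 1) ≤ (9 * c + 6 - (b + 1)) * (3 * c + 1 + b * c) := by
    refine le_of_mul_le_mul_left (a := b + 1) ?_ (Nat.succ_pos _)
    calc _ = _ := by ring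
      _ ≤ _ := i3
      _ = _ := by ring
  have hb1 : b + 1 ≤ 9 * c + 6 := by omega
  -- At `e = 0` the two sides of `h1` differ by `(2 * c + 1) * (2 * c ^ 2 - 6 * c - 4)`, which is
  -- positive exactly from `c = 4` on; the terms in `e` only enlarge the gap.
  obtain ⟨e, rfl⟩ : ∃ e, b = 2 * c + e := ⟨b - 2 * c, by omega⟩
  zify [hb1] at h1 hc
  have he : (0 : ℤ) ≤ e := Int.natCast_nonneg _
  nlinarith [mul_nonneg he he, mul_nonneg he (by linarith : (0 : ℤ) ≤ c),
    mul_nonneg (mul_nonneg he he) (by linarith : (0 : ℤ) ≤ c),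
    mul_nonneg he (mul_nonneg (by linarith : (0 : ℤ) ≤ c) (by linarith : (0 : ℤ) ≤ c - 4)),
    mul_nonneg (by linarith : (0 : ℤ) ≤ c - 4) (mul_nonneg (by linarith : (0 : ℤ) ≤ c) (by linarith : (0 : ℤ) ≤ c - 4)), mul_nonneg (by linarith : (0 : ℤ) ≤ c) (by linarith : (0 : ℤ) ≤ c - 4)]

/-! ### Cyclic lists of vertices -/

/-- A list of distinct vertices, each adjacent to the next and the last adjacent to the first. -/
def IsCyclicList {V : Type*} (G : SimpleGraph V) (l : List V) : Prop :=
  l.Nodup ∧ Cycle.Chain G.Adj (l : Cycle V)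

namespace IsCyclicList

variable {V : Type*} {G : SimpleGraph V}

theorem of_isRotated {l l' : List V} (h : G.IsCyclicList l) (hr : l ~r l') :
    G.IsCyclicList l' :=
  ⟨hr.nodup_iff.1 h.1, Cycle.coe_eq_coe.2 hr ▸ h.2⟩

theorem mono {G' : SimpleGraph V} (hG : G ≤ G') {l : List V} (h : G.IsCyclicList l) :
    G'.IsCyclicList l :=
  ⟨h.1, h.2.imp fun _ _ hab => hG hab⟩

/-- Insert a detour `P` between two consecutive vertices of a cyclic list. -/
theorem insert_detour {x y : V} {B P : List V} (h : G.IsCyclicList (x :: y :: B))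
    (hnd : P.Nodup) (hdis : ∀ w ∈ P, w ∉ x :: y :: B)
    (hP : List.IsChain G.Adj (x :: (P ++ [y]))) : G.IsCyclicList (x :: (P ++ y :: B)) := by
  obtain ⟨h1, h2⟩ := h
  rw [Cycle.chain_coe_cons] at h2
  refine ⟨?_, ?_⟩
  · have : (x :: (P ++ y :: B)).Perm (P ++ x :: y :: B) := List.perm_middle.symm
    rw [this.nodup_iff, List.nodup_append']
    exact ⟨hnd, h1, fun w hw hw' => hdis w hw hw'⟩
  · rw [Cycle.chain_coe_cons]
    have : x :: (P ++ y :: B ++ [x]) = (x :: P) ++ y :: (B ++ [x]) := by simp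
    rw [this, List.isChain_split]
    exact ⟨by simpa using hP, (List.isChain_cons_cons.1 (by simpa using h2)).2⟩

/-- Given a detour `P` from `x` to `y` off a cyclic list and an edge between the successors of
`x` and `y`, reroute the list through `P`. -/
theorem reroute {x y a b : V} {A B P : List V}
    (h : G.IsCyclicList (x :: a :: (A ++ y :: b :: B)))
    (hnd : P.Nodup) (hdis : ∀ w ∈ P, w ∉ x :: a :: (A ++ y :: b :: B))
    (hP : List.IsChain G.Adj (x :: (P ++ [y]))) (hab : G.Adj a b) :
    G.IsCyclicList (x :: (P ++ y :: (A.reverse ++ a :: b :: B))) := by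
  obtain ⟨h1, h2⟩ := h
  rw [Cycle.chain_coe_cons] at h2
  refine ⟨?_, ?_⟩
  · have hp1 : (x :: (P ++ y :: (A.reverse ++ a :: b :: B))).Perm
        (P ++ x :: a :: (A ++ y :: b :: B)) := by
      classical
      rw [List.perm_iff_count]
      intro z
      simp only [List.count_cons, List.count_append, List.count_reverse]
      omega
    rw [hp1.nodup_iff, List.nodup_append']
    exact ⟨hnd, h1, fun w hw hw' => hdis w hw hw'⟩
  · rw [Cycle.chain_coe_cons]
    have e1 : x :: (P ++ y :: (A.reverse ++ a :: b :: B) ++ [x]) =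
        (x :: P) ++ y :: (A.reverse ++ a :: b :: (B ++ [x])) := by simp
    have e2 : y :: (A.reverse ++ a :: b :: (B ++ [x])) =
        (y :: A.reverse) ++ a :: b :: (B ++ [x]) := by simp
    have e3 : x :: (a :: (A ++ y :: b :: B) ++ [x]) =
        [x] ++ a :: (A ++ y :: b :: (B ++ [x])) := by simp
    have e4 : a :: (A ++ y :: b :: (B ++ [x])) = (a :: A) ++ y :: b :: (B ++ [x]) := by simp
    rw [e3, List.isChain_split, e4] at h2
    have h3 := List.isChain_split.1 h2.2
    rw [List.isChain_cons_cons] at h3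
    rw [e1, List.isChain_split, e2]
    refine ⟨by simpa using hP, List.isChain_split.2 ⟨?_, List.isChain_cons_cons.2 ⟨hab, h3.2.2⟩⟩⟩
    have := List.isChain_reverse.2 (h3.1.imp (S := flip G.Adj) fun _ _ (h : G.Adj _ _) => h.symm)
    simpa [flip] using this

/-! ### Rotations and successors along a cyclic list -/

section Successor

variable [DecidableEq V]

theorem exists_isRotated_succ {l : List V} (h : l.Nodup) (hl : 2 ≤ l.length) {x : V}
    (hx : x ∈ l) : ∃ B, l ~r x :: l.formPerm x :: B := by
  obtain ⟨s, t, rfl⟩ := List.append_of_mem hx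
  have hr : (s ++ x :: t) ~r (x :: t ++ s) := List.isRotated_append
  obtain ⟨y, B, hyB⟩ : ∃ y B, t ++ s = y :: B := by
    refine List.exists_cons_of_length_pos ?_
    simp at hl ⊢; omega
  have e : x :: t ++ s = x :: y :: B := by simp [hyB]
  rw [e] at hr
  refine ⟨B, ?_⟩
  rw [List.formPerm_eq_of_isRotated h hr, List.formPerm_apply_head _ _ _ (hr.nodup_iff.1 h)]
  exact hr

/-- `formPerm` serves as the successor map. This puts the list in the shape required by `reroute`,
which needs `x` and `y` not consecutive. -/
theorem exists_isRotated_succ_succ {l : List V} (h : l.Nodup) (hl : 2 ≤ l.length) {x y : V}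
    (hx : x ∈ l) (hy : y ∈ l) (hxy : x ≠ y) (h1 : l.formPerm x ≠ y) (h2 : l.formPerm y ≠ x) :
    ∃ A B, l ~r x :: l.formPerm x :: (A ++ y :: l.formPerm y :: B) := by
  obtain ⟨M, hM⟩ := exists_isRotated_succ h hl hx
  have hyM : y ∈ M := by
    have := hM.mem_iff.1 hy
    simp only [List.mem_cons] at this
    rcases this with rfl | rfl | h
    · exact absurd rfl hxy
    · exact absurd rfl h1
    · exact h
  obtain ⟨A, N, rfl⟩ := List.append_of_mem hyM
  have hr2 : l ~r (y :: N ++ x :: l.formPerm x :: A) :=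
    hM.trans (List.isRotated_append (l := x :: l.formPerm x :: A) (l' := y :: N))
  have hs := List.formPerm_eq_of_isRotated h hr2
  cases N with
  | nil =>
    refine absurd ?_ h2
    rw [hs]
    exact List.formPerm_apply_head _ _ _ (hr2.nodup_iff.1 h)
  | cons b B =>
    have hb : l.formPerm y = b := by
      conv_lhs => rw [hs]
      exact List.formPerm_apply_head _ _ _ (hr2.nodup_iff.1 h)
    exact ⟨A, B, hb.symm ▸ hM⟩

end Successor

/-- A cyclic list of length at least three through all vertices gives a Hamiltonian cycle. -/
theorem exists_isHamiltonianCycle [DecidableEq V] {l : List V} (h : G.IsCyclicList l)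
    (hl : 3 ≤ l.length) (hall : ∀ v, v ∈ l) :
    ∃ (x : V) (c : G.Walk x x), c.IsHamiltonianCycle := by
  obtain ⟨hnd, hch⟩ := h
  obtain _ | ⟨a, l⟩ := l
  · simp at hl
  rw [Cycle.chain_coe_cons] at hch
  obtain _ | ⟨b, l⟩ := l
  · simp at hl
  rw [List.cons_append, List.isChain_cons_cons] at hch
  let p := Walk.ofSupport (G := G) (b :: l ++ [a]) (by simp) hch.2
  have hps : p.support = b :: l ++ [a] := Walk.support_ofSupport _ _
  have hb : (b :: l ++ [a]).head (by simp) = b := rfl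
  have ha : (b :: l ++ [a]).getLast (by simp) = a := by simp
  let q : G.Walk b a := p.copy hb ha
  have hqs : q.support = b :: l ++ [a] := (Walk.support_copy p hb ha).trans hps
  have hperm : (b :: l ++ [a]).Perm (a :: b :: l) := List.perm_append_singleton _ _
  have hqn : q.support.Nodup := by rw [hqs, hperm.nodup_iff]; exact hnd
  have hqp : q.IsPath := Walk.IsPath.mk' hqn
  refine ⟨a, Walk.cons hch.1 q, ?_⟩
  rw [Walk.isHamiltonianCycle_iff_isCycle_and_support_count_tail_eq_one]
  constructor
  · rw [Walk.cons_isCycle_iff]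
    refine ⟨hqp, fun he => ?_⟩
    have hlen : q.length + 1 = (b :: l ++ [a]).length := by rw [← hqs, Walk.length_support]
    have := hqp.length_eq_one_of_mem_edges (Sym2.eq_swap ▸ he)
    simp at hl hlen
    omega
  · intro v
    rw [Walk.support_cons, List.tail_cons]
    refine List.count_eq_one_of_mem hqn ?_
    rw [hqs, hperm.mem_iff]
    exact hall v

end IsCyclicList

/-! ### Longest cyclic lists -/

/-- If `x` and `y` both have neighbours in the same component of the complement of `l`, there is
a detour from `x` to `y` avoiding `l`. -/
theorem exists_detour {V : Type*} {G : SimpleGraph V} {L : Set V} {x y : V} {u v : V}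
    (hu : u ∈ L) (hv : v ∈ L) (huv : (G.induce L).Reachable ⟨u, hu⟩ ⟨v, hv⟩)
    (hx : G.Adj x u) (hy : G.Adj v y) :
    ∃ P : List V, P ≠ [] ∧ P.Nodup ∧ (∀ w ∈ P, w ∈ L) ∧
      List.IsChain G.Adj (x :: (P ++ [y])) := by
  classical
  obtain ⟨p, hp⟩ := huv.exists_isPath
  let q : G.Walk u v := p.map (Embedding.induce L).toHom
  have hq : q.support = p.support.map Subtype.val :=
    Walk.support_map _ p
  refine ⟨q.support, Walk.support_ne_nil _, ?_, ?_, ?_⟩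
  · rw [hq]
    exact hp.support_nodup.map Subtype.val_injective
  · rw [hq]
    intro w hw
    obtain ⟨z, -, rfl⟩ := List.mem_map.1 hw
    exact z.2
  · have := (Walk.cons hx (q.append (Walk.cons hy Walk.nil))).isChain_adj_support
    simpa [Walk.support_append] using this


/-- A longest cyclic list `l`, a set `D` of vertices off `l` closed under adjacency off `l` and
joined by paths off `l`: the successors of the vertices of `l` having neighbours in `D` have no
neighbours in `D` and are pairwise nonadjacent. -/
theorem IsCyclicList.independent_succ_of_longest {V : Type*} [DecidableEq V] {G : SimpleGraph V}
    {l : List V} (h : G.IsCyclicList l) (hl : 2 ≤ l.length)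
    (hmax : ∀ l', G.IsCyclicList l' → l'.length ≤ l.length) {D : Set V}
    (hD : ∀ x y u v, u ∈ D → v ∈ D → G.Adj x u → G.Adj v y →
      ∃ P : List V, P ≠ [] ∧ P.Nodup ∧ (∀ w ∈ P, w ∉ l) ∧ List.IsChain G.Adj (x :: (P ++ [y]))) :
    (∀ x ∈ l, ∀ u ∈ D, ∀ v ∈ D, G.Adj x u → ¬ G.Adj v (l.formPerm x)) ∧
    (∀ x ∈ l, ∀ y ∈ l, x ≠ y → ∀ u ∈ D, ∀ v ∈ D, G.Adj x u → G.Adj v y →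
      ¬ G.Adj (l.formPerm x) (l.formPerm y)) := by
  have key : ∀ x ∈ l, ∀ u ∈ D, ∀ v ∈ D, G.Adj x u → ¬ G.Adj v (l.formPerm x) := by
    intro x hx u hu v hv hxu hvy
    obtain ⟨P, hP0, hPn, hPl, hPc⟩ := hD _ _ _ _ hu hv hxu hvy
    obtain ⟨B, hB⟩ := exists_isRotated_succ h.1 hl hx
    have := hmax _ ((h.of_isRotated hB).insert_detour hPn
      (fun w hw hw' => hPl w hw (hB.mem_iff.2 hw')) hPc)
    have hlen := List.length_pos_iff.2 hP0
    rw [hB.perm.length_eq] at this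
    simp only [List.length_cons, List.length_append] at this
    omega
  refine ⟨key, ?_⟩
  intro x hx y hy hxy u hu v hv hxu hvy hadj
  obtain ⟨P, hP0, hPn, hPl, hPc⟩ := hD _ _ _ _ hu hv hxu hvy
  -- By `key`, a successor of an attachment vertex is not itself attached to `D`, so `x` and `y` are
  -- not consecutive.
  obtain ⟨A, B, hB⟩ := exists_isRotated_succ_succ h.1 hl hx hy hxy
    (fun e => key x hx u hu v hv hxu (e ▸ hvy))
    (fun e => key y hy v hv u hu hvy.symm (e ▸ hxu.symm))
  have := hmax _ ((h.of_isRotated hB).reroute hPn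
    (fun w hw hw' => hPl w hw (hB.mem_iff.2 hw')) hPc hadj)
  have hlen := List.length_pos_iff.2 hP0
  rw [hB.perm.length_eq] at this
  simp only [List.length_cons, List.length_append, List.length_reverse] at this
  omega

/-- A graph with an edge has a longest cyclic list. -/
theorem exists_longest_isCyclicList {V : Type*} [Fintype V] {G : SimpleGraph V} {a b : V}
    (hab : G.Adj a b) : ∃ l, G.IsCyclicList l ∧ 2 ≤ l.length ∧
      ∀ l', G.IsCyclicList l' → l'.length ≤ l.length := by
  classical
  let P : ℕ → Prop := fun n => ∃ l, G.IsCyclicList l ∧ l.length = n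
  have h2 : P 2 := ⟨[a, b], ⟨by simp [hab.ne], by simp [Cycle.chain_coe_cons, hab, hab.symm]⟩, rfl⟩
  have hle : ∀ l, G.IsCyclicList l → l.length ≤ Fintype.card V := fun l h => h.1.length_le_card
  have h2c : 2 ≤ Fintype.card V := by
    obtain ⟨l, h, e⟩ := h2
    exact e ▸ hle l h
  obtain ⟨l, h, e⟩ := Nat.findGreatest_spec h2c h2
  refine ⟨l, h, e ▸ Nat.le_findGreatest h2c h2, fun l' h' => ?_⟩
  rw [e]
  exact Nat.le_findGreatest (hle l' h') ⟨l', h', rfl⟩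

/-- A `(3c+1)`-regular graph on `9c+6` vertices with at most `c` common neighbours for any two
distinct vertices has a cyclic list through all vertices, provided that `4 ≤ c`. -/
theorem exists_isCyclicList_forall_mem {V : Type*} [Fintype V] [DecidableEq V] [Nonempty V]
    (G : SimpleGraph V) [DecidableRel G.Adj] {c : ℕ} (hc : 4 ≤ c)
    (hcard : Fintype.card V = 9 * c + 6) (hdeg : ∀ s, #{w | G.Adj w s} = 3 * c + 1)
    (hcom : ∀ s t, s ≠ t → #{w | G.Adj w s ∧ G.Adj w t} ≤ c) :
    ∃ l, G.IsCyclicList l ∧ ∀ v, v ∈ l := by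
  classical
  obtain ⟨a, b, hab⟩ : ∃ a b, G.Adj a b := by
    obtain ⟨s⟩ := ‹Nonempty V›
    have : 0 < #{w | G.Adj w s} := by rw [hdeg]; omega
    obtain ⟨w, hw⟩ := Finset.card_pos.1 this
    exact ⟨w, s, by simpa using hw⟩
  obtain ⟨l, h, hl, hmax⟩ := exists_longest_isCyclicList hab
  refine ⟨l, h, ?_⟩
  by_contra! hv
  obtain ⟨v, hv⟩ := hv
  let L : Set V := {w | w ∉ l}
  have hvL : v ∈ L := hv
  -- The component, off the cycle, of the missed vertex `v`.
  let D : Set V := {w | ∃ hw : w ∈ L, (G.induce L).Reachable ⟨v, hvL⟩ ⟨w, hw⟩}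
  have hvD : v ∈ D := ⟨hvL, Reachable.refl _⟩
  have hDl : ∀ w ∈ D, w ∉ l := fun w hw => hw.1
  have hDc : ∀ w ∈ D, ∀ z, G.Adj w z → z ∉ l → z ∈ D := by
    rintro w ⟨hw, hr⟩ z hz hzl
    refine ⟨hzl, hr.trans (Adj.reachable ?_)⟩
    simpa using hz
  obtain ⟨hs1, hs2⟩ := h.independent_succ_of_longest hl hmax (D := D) (by
    rintro x y u w ⟨hu, hur⟩ ⟨hw, hwr⟩ hxu hwy
    exact exists_detour hu hw (hur.symm.trans hwr) hxu hwy)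
  let Df : Finset V := {w | w ∈ D}
  let B : Finset V := {x | x ∈ l ∧ ∃ u ∈ D, G.Adj x u}
  let R : Finset V := {x | x ∉ D ∧ x ∉ B}
  let S : Finset V := B.image l.formPerm
  have hSl : ∀ y ∈ S, y ∈ l := by
    intro y hy
    obtain ⟨x, hx, rfl⟩ := Finset.mem_image.1 hy
    exact List.formPerm_apply_mem_of_mem (Finset.mem_filter.1 hx).2.1
  have hSD : ∀ y ∈ S, ∀ u ∈ D, ¬ G.Adj u y := by
    intro y hy u hu
    obtain ⟨x, hx, rfl⟩ := Finset.mem_image.1 hy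
    obtain ⟨hxl, w, hw, hxw⟩ := (Finset.mem_filter.1 hx).2
    exact hs1 x hxl w hw u hu hxw
  have hSR : S ⊆ R := by
    intro y hy
    refine Finset.mem_filter.2 ⟨Finset.mem_univ _, fun hyD => hDl y hyD (hSl y hy), fun hyB => ?_⟩
    obtain ⟨-, u, hu, hyu⟩ := (Finset.mem_filter.1 hyB).2
    exact hSD y hy u hu hyu.symm
  have hScard : #S = #B := Finset.card_image_of_injective _ l.formPerm.injective
  have hDB : Disjoint Df B := by
    rw [Finset.disjoint_left]
    intro x hx hxB
    exact hDl x (Finset.mem_filter.1 hx).2 (Finset.mem_filter.1 hxB).2.1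
  have hDR : Rᶜ = Df ∪ B := by
    ext x
    simp only [R, Df, Finset.mem_compl, Finset.mem_filter, Finset.mem_univ, true_and,
      Finset.mem_union]
    tauto
  have hRB : Disjoint R B := by
    rw [Finset.disjoint_left]
    intro x hx
    exact (Finset.mem_filter.1 hx).2.2
  have hDR' : Dfᶜ = R ∪ B := by
    ext x
    have hx : x ∈ Df → x ∉ B := fun h1 h2 => Finset.disjoint_left.1 hDB h1 h2
    simp only [R, Df, Finset.mem_compl, Finset.mem_filter, Finset.mem_univ, true_and,
      Finset.mem_union] at hx ⊢
    tauto
  have hn : #Df + #B + #R = 9 * c + 6 := by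
    rw [← hcard, ← Finset.card_union_of_disjoint hDB, ← hDR, Finset.card_compl]
    exact Nat.sub_add_cancel (Finset.card_le_univ _)
  have hadj : ∀ s ∈ Df, ∀ z ∈ R, ¬ G.Adj s z := by
    intro s hs z hz hsz
    have hs := (Finset.mem_filter.1 hs).2
    obtain ⟨hz1, hz2⟩ := (Finset.mem_filter.1 hz).2
    by_cases hzl : z ∈ l
    · exact hz2 (Finset.mem_filter.2 ⟨Finset.mem_univ _, hzl, s, hs, hsz.symm⟩)
    · exact hz1 (hDc s hs z hsz hzl)
  have hD0 : 1 ≤ #Df := Finset.card_pos.2 ⟨v, Finset.mem_filter.2 ⟨Finset.mem_univ _, hvD⟩⟩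
  have hR0 : 1 ≤ #R := by
    obtain ⟨x, hx⟩ := List.exists_mem_of_length_pos (by omega : 0 < l.length)
    rw [Nat.one_le_iff_ne_zero, Finset.card_ne_zero]
    by_cases hxB : x ∈ B
    · exact ⟨_, hSR (Finset.mem_image_of_mem _ hxB)⟩
    · exact ⟨x, Finset.mem_filter.2 ⟨Finset.mem_univ _, fun h => hDl x h hx, hxB⟩⟩
  have i1 := G.sq_card_le_of_not_adj hdeg hcom Df R hadj
  have i2 := G.sq_card_le_of_not_adj hdeg hcom R Df fun s hs z hz h => hadj z hz s hs h.symm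
  rw [hDR, Finset.card_union_of_disjoint hDB] at i1
  rw [hDR', Finset.card_union_of_disjoint hRB] at i2
  have hvS : v ∉ S := fun h => hv (hSl v h)
  -- An independent set has no edges to itself, so it may play both roles.
  have i3 := G.sq_card_le_of_not_adj hdeg hcom (insert v S) (insert v S) (by
    intro s hs t ht hst
    rcases Finset.mem_insert.1 hs with rfl | hs <;> rcases Finset.mem_insert.1 ht with rfl | ht
    · exact hst.ne rfl
    · exact hSD t ht _ hvD hst
    · exact hSD s hs _ hvD hst.symm
    · obtain ⟨x, hx, rfl⟩ := Finset.mem_image.1 hs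
      obtain ⟨y, hy, rfl⟩ := Finset.mem_image.1 ht
      obtain ⟨hxl, u, hu, hxu⟩ := (Finset.mem_filter.1 hx).2
      obtain ⟨hyl, w, hw, hyw⟩ := (Finset.mem_filter.1 hy).2
      exact hs2 x hxl y hyl (fun e => hst.ne (e ▸ rfl)) u hu w hw hxu hyw.symm hst)
  rw [Finset.card_compl, Finset.card_insert_of_notMem hvS, hScard, hcard] at i3
  exact absurd_of_expansion hc hD0 hR0 hn i1 i2 i3

end SimpleGraph

open Matrix

/-! ### The action of `SL(2, F)` on the plane -/

section Plane

variable {F : Type*} [Field F]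

/-- The determinant of the matrix with columns `u` and `v`. -/
def wedge (u v : Fin 2 → F) : F := u 0 * v 1 - u 1 * v 0

theorem wedge_self (u : Fin 2 → F) : wedge u u = 0 := by simp only [wedge]; ring

theorem wedge_swap (u v : Fin 2 → F) : wedge v u = -wedge u v := by simp only [wedge]; ring

theorem wedge_smul_left (a : F) (u v : Fin 2 → F) : wedge (a • u) v = a * wedge u v := by
  simp only [wedge, Pi.smul_apply, smul_eq_mul]; ring

theorem wedge_smul_right (a : F) (u v : Fin 2 → F) : wedge u (a • v) = a * wedge u v := by
  simp only [wedge, Pi.smul_apply, smul_eq_mul]; ring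

theorem sl_smul_apply (g : SpecialLinearGroup (Fin 2) F) (v : Fin 2 → F) (i : Fin 2) :
    (g • v) i = g.1 i 0 * v 0 + g.1 i 1 * v 1 := by
  rw [Matrix.SpecialLinearGroup.smul_def]
  change (g.1 *ᵥ v) i = _
  simp [Matrix.mulVec, dotProduct, Fin.sum_univ_two]

theorem exists_sl_smul_apply {a b c d : F} (h : a * d - b * c = 1) :
    ∃ g : SpecialLinearGroup (Fin 2) F, ∀ v : Fin 2 → F,
      (g • v) 0 = a * v 0 + b * v 1 ∧ (g • v) 1 = c * v 0 + d * v 1 := by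
  obtain ⟨g, hg⟩ : ∃ g : SpecialLinearGroup (Fin 2) F, g.1 = !![a, b; c, d] :=
    ⟨⟨!![a, b; c, d], by rw [Matrix.det_fin_two_of, h]⟩, rfl⟩
  refine ⟨g, fun v => ?_⟩
  rw [sl_smul_apply, sl_smul_apply, hg]
  simp

theorem wedge_sl_smul (g : SpecialLinearGroup (Fin 2) F) (u v : Fin 2 → F) :
    wedge (g • u) (g • v) = wedge u v := by
  have h := g.2
  rw [Matrix.det_fin_two] at h
  simp only [wedge, sl_smul_apply]
  linear_combination (u 0 * v 1 - u 1 * v 0) * h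

theorem exists_wedge_eq {u : Fin 2 → F} (hu : u ≠ 0) (d : F) : ∃ w, wedge u w = d := by
  by_cases h0 : u 0 = 0
  · have h1 : u 1 ≠ 0 := fun h1 => hu (by ext i; fin_cases i <;> simp [h0, h1])
    exact ⟨![-d / u 1, 0], by simp [wedge]; field_simp⟩
  · exact ⟨![0, d / u 0], by simp [wedge]; field_simp⟩

theorem exists_eq_smul_of_wedge_eq_zero {u v : Fin 2 → F} (hu : u ≠ 0) (h : wedge u v = 0) :
    ∃ a : F, v = a • u := by
  simp only [wedge] at h
  by_cases h0 : u 0 = 0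
  · have h1 : u 1 ≠ 0 := fun h1 => hu (by ext i; fin_cases i <;> simp [h0, h1])
    have h2 : v 0 = 0 := by simpa [h0, h1] using h
    refine ⟨v 1 / u 1, ?_⟩
    ext i; fin_cases i <;> simp [h0, h1, h2]
  · refine ⟨v 0 / u 0, ?_⟩
    ext i; fin_cases i
    · simp [h0]
    · simp; field_simp; linear_combination h

theorem eq_of_wedge_eq {s t v v' : Fin 2 → F} (hst : wedge s t ≠ 0)
    (h1 : wedge s v = wedge s v') (h2 : wedge t v = wedge t v') : v = v' := by
  simp only [wedge] at *
  have e0 : (s 0 * t 1 - s 1 * t 0) * (v 0 - v' 0) = 0 := by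
    linear_combination t 0 * h1 - s 0 * h2
  have e1 : (s 0 * t 1 - s 1 * t 0) * (v 1 - v' 1) = 0 := by
    linear_combination t 1 * h1 - s 1 * h2
  ext i; fin_cases i
  · exact sub_eq_zero.1 ((mul_eq_zero.1 e0).resolve_left hst)
  · exact sub_eq_zero.1 ((mul_eq_zero.1 e1).resolve_left hst)

theorem sl_eq_of_smul_eq {s t : Fin 2 → F} (hst : wedge s t ≠ 0)
    {g g' : SpecialLinearGroup (Fin 2) F} (h1 : g • s = g' • s) (h2 : g • t = g' • t) :
    g = g' := by
  ext i j
  have e1 := congrFun h1 i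
  have e2 := congrFun h2 i
  rw [sl_smul_apply, sl_smul_apply] at e1 e2
  have f0 : (s 0 * t 1 - s 1 * t 0) * (g.1 i 0 - g'.1 i 0) = 0 := by
    linear_combination t 1 * e1 - s 1 * e2
  have f1 : (s 0 * t 1 - s 1 * t 0) * (g.1 i 1 - g'.1 i 1) = 0 := by
    linear_combination - t 0 * e1 + s 0 * e2
  fin_cases j
  · exact sub_eq_zero.1 ((mul_eq_zero.1 f0).resolve_left hst)
  · exact sub_eq_zero.1 ((mul_eq_zero.1 f1).resolve_left hst)

/-- The matrix is `[u' v'] [u v]⁻¹`; equality of the determinants puts it in SL. -/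
theorem exists_sl_smul_eq {u v u' v' : Fin 2 → F} (h : wedge u v ≠ 0)
    (h' : wedge u v = wedge u' v') :
    ∃ g : SpecialLinearGroup (Fin 2) F, g • u = u' ∧ g • v = v' := by
  have hd : (wedge u v)⁻¹ * wedge u v = 1 := inv_mul_cancel₀ h
  obtain ⟨e, he⟩ : ∃ e, e = (wedge u v)⁻¹ := ⟨_, rfl⟩
  rw [← he] at hd
  have hd' : e * wedge u' v' = 1 := h' ▸ hd
  simp only [wedge] at hd hd'
  obtain ⟨g, hg⟩ := exists_sl_smul_apply (a := e * (u' 0 * v 1 - v' 0 * u 1))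
    (b := e * (v' 0 * u 0 - u' 0 * v 0)) (c := e * (u' 1 * v 1 - v' 1 * u 1))
    (d := e * (v' 1 * u 0 - u' 1 * v 0))
    (by linear_combination (e * (u' 0 * v' 1 - u' 1 * v' 0)) * hd + hd')
  refine ⟨g, ?_, ?_⟩
  · ext i
    fin_cases i
    · exact (hg u).1.trans (show _ = u' 0 by linear_combination u' 0 * hd)
    · exact (hg u).2.trans (show _ = u' 1 by linear_combination u' 1 * hd)
  · ext i
    fin_cases i
    · exact (hg v).1.trans (show _ = v' 0 by linear_combination v' 0 * hd)
    · exact (hg v).2.trans (show _ = v' 1 by linear_combination v' 1 * hd)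

/-- The transvection `v ↦ v + wedge u v • u`. -/
theorem exists_transvection (u : Fin 2 → F) :
    ∃ g : SpecialLinearGroup (Fin 2) F, ∀ v, g • v = v + wedge u v • u := by
  obtain ⟨g, hg⟩ := exists_sl_smul_apply (a := 1 - u 0 * u 1) (b := u 0 * u 0)
    (c := -(u 1 * u 1)) (d := 1 + u 0 * u 1) (by ring)
  refine ⟨g, fun v => ?_⟩
  ext i
  fin_cases i
  · exact (hg v).1.trans (by simp [wedge]; ring)
  · exact (hg v).2.trans (by simp [wedge]; ring)

/-! ### The center and vector stabilizers -/

theorem exists_smul_eq_of_mem_center {g : SpecialLinearGroup (Fin 2) F}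
    (hg : g ∈ Subgroup.center (SpecialLinearGroup (Fin 2) F)) :
    ∃ r : F, (r = 1 ∨ r = -1) ∧ ∀ v : Fin 2 → F, g • v = r • v := by
  obtain ⟨r, hr, hrg⟩ := Matrix.SpecialLinearGroup.mem_center_iff.1 hg
  refine ⟨r, sq_eq_one_iff.1 (by simpa using hr), fun v => ?_⟩
  ext i
  rw [sl_smul_apply, ← hrg]
  fin_cases i <;> simp

theorem card_center_sl_two (p : ℕ) [CharP F p] (hp : p ≠ 2) :
    Nat.card (Subgroup.center (SpecialLinearGroup (Fin 2) F)) = 2 := by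
  rw [Nat.card_congr (Matrix.SpecialLinearGroup.center_equiv_rootsOfUnity).toEquiv]
  exact (IsPrimitiveRoot.neg_one (R := F) p hp).card_rootsOfUnity

/-- For `w` with `wedge u w = 1`, an element fixing `u` is determined by the image of `w`, whose
determinant with `u` is prescribed; one free coordinate remains. -/
theorem card_stabilizer_le [Finite F] {u : Fin 2 → F} (hu : u ≠ 0) :
    Nat.card (MulAction.stabilizer (SpecialLinearGroup (Fin 2) F) u) ≤ Nat.card F := by
  obtain ⟨w, hw⟩ := exists_wedge_eq hu 1
  have hw0 : wedge u w ≠ 0 := by rw [hw]; exact one_ne_zero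
  refine Nat.card_le_card_of_injective
    (fun g : MulAction.stabilizer (SpecialLinearGroup (Fin 2) F) u => wedge w (g.1 • w)) ?_
  intro g g' hgg
  refine Subtype.ext (sl_eq_of_smul_eq hw0 (g.2.trans g'.2.symm) (eq_of_wedge_eq hw0 ?_ hgg))
  have e : ∀ g : MulAction.stabilizer (SpecialLinearGroup (Fin 2) F) u,
      wedge u (g.1 • w) = wedge u w := fun g => by
    have := wedge_sl_smul g.1 u w
    rwa [show g.1 • u = u from g.2] at this
  rw [e, e]

end Plane

/-! ### The preimage of `H` in SL(2, F) -/

theorem Subgroup.card_comap_of_surjective {G K : Type*} [Group G] [Group K] {f : G →* K}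
    (hf : Function.Surjective f) (H : Subgroup K) :
    Nat.card (H.comap f) = Nat.card f.ker * Nat.card H := by
  have h1 := Subgroup.relIndex_mul_relIndex ⊥ f.ker (H.comap f) bot_le
    (fun g hg => by rw [Subgroup.mem_comap, hg]; exact H.one_mem)
  rw [Subgroup.relIndex_bot_left, Subgroup.relIndex_bot_left, Subgroup.relIndex_ker,
    Subgroup.map_comap_eq_self_of_surjective hf] at h1
  exact h1.symm

/-- A subgroup of `G` isomorphic to `F ⋊ ℤ_n` contains a copy of `F` that it normalizes. -/
theorem IsAddSemidirectCyclic.exists_normal {F : Type*} [AddGroup F] {n : ℕ} {G : Type*} [Group G]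
    {H : Subgroup G} (hH : IsAddSemidirectCyclic F n H) :
    Nat.card H = Nat.card F * n ∧ ∃ Q ≤ H, Nat.card Q = Nat.card F ∧
      ∀ h ∈ H, ∀ q ∈ Q, h * q * h⁻¹ ∈ Q := by
  obtain ⟨φ, ⟨e⟩⟩ := hH
  refine ⟨?_, ?_⟩
  · rw [Nat.card_congr e.toEquiv, SemidirectProduct.card]
    congr 1
    exact Nat.card_zmod n
  let ι : Multiplicative F ⋊[φ] Multiplicative (ZMod n) →* G := H.subtype.comp e.symm.toMonoidHom
  have hι : Function.Injective ι := H.subtype_injective.comp e.symm.injective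
  refine ⟨(ι.comp SemidirectProduct.inl).range, ?_, ?_, ?_⟩
  · rintro _ ⟨x, rfl⟩
    exact (e.symm _).2
  · exact (Nat.card_congr (Equiv.ofInjective (ι.comp SemidirectProduct.inl)
      (hι.comp SemidirectProduct.inl_injective))).symm
  · rintro h hh _ ⟨x, rfl⟩
    have hs : h = ι (e ⟨h, hh⟩) := by simp [ι]
    have hm : e ⟨h, hh⟩ * SemidirectProduct.inl x * (e ⟨h, hh⟩)⁻¹ ∈
        (SemidirectProduct.inl : Multiplicative F →* _ ⋊[φ] Multiplicative (ZMod n)).range := by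
      rw [SemidirectProduct.range_inl_eq_ker_rightHom]
      refine (inferInstance : (SemidirectProduct.rightHom (φ := φ)).ker.Normal).conj_mem _ ?_ _
      simp [MonoidHom.mem_ker]
    obtain ⟨y, hy⟩ := hm
    refine ⟨y, ?_⟩
    change ι (SemidirectProduct.inl y) = h * ι (SemidirectProduct.inl x) * h⁻¹
    rw [hy, map_mul, map_mul, map_inv, ← hs]

/-- A subgroup of `PSL(2, F)` of order `|F| n` with a normal subgroup of order `|F|` consists of
the elements whose lifts multiply a fixed nonzero vector by a scalar in a group of order `2n`. -/
theorem exists_eigenvector_of_normal {F : Type*} [Field F] [Finite F] (hodd : ¬ 2 ∣ Nat.card F)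
    {n : ℕ} (H : Subgroup (Matrix.ProjectiveSpecialLinearGroup (Fin 2) F))
    (hcard : Nat.card H = Nat.card F * n)
    (Q : Subgroup (Matrix.ProjectiveSpecialLinearGroup (Fin 2) F)) (hQH : Q ≤ H)
    (hQ : Nat.card Q = Nat.card F) (hn : ∀ h ∈ H, ∀ q ∈ Q, h * q * h⁻¹ ∈ Q) :
    ∃ u : Fin 2 → F, u ≠ 0 ∧ ∃ C : Subgroup Fˣ, Nat.card C = 2 * n ∧ -1 ∈ C ∧
      ∀ g : SpecialLinearGroup (Fin 2) F,
        QuotientGroup.mk' (Subgroup.center (SpecialLinearGroup (Fin 2) F)) g ∈ H ↔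
          ∃ a ∈ C, g • u = (a : F) • u := by
  classical
  let _ := Fintype.ofFinite F
  obtain ⟨p, hchar⟩ := CharP.exists F
  obtain ⟨m, hp, hFp⟩ := FiniteField.card F p
  have : Fact p.Prime := ⟨hp⟩
  rw [← Nat.card_eq_fintype_card] at hFp
  have hpF : p ∣ Nat.card F := hFp ▸ dvd_pow_self p m.pos.ne'
  have hp2 : p ≠ 2 := fun h => hodd (h ▸ hpF)
  have h2 : (2 : F) ≠ 0 := Ring.two_ne_zero (by rwa [ringChar.eq F p])
  have hkpos : 0 < Nat.card F := Nat.card_pos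
  set f := QuotientGroup.mk' (Subgroup.center (SpecialLinearGroup (Fin 2) F)) with hf
  have hfs : Function.Surjective f := QuotientGroup.mk'_surjective _
  have hker : f.ker = Subgroup.center (SpecialLinearGroup (Fin 2) F) := QuotientGroup.ker_mk' _
  obtain ⟨P, hPQ, hPcard⟩ : ∃ P ≤ Q.comap f, Nat.card P = p ^ (m : ℕ) := by
    obtain ⟨P, hP⟩ := Sylow.exists_subgroup_card_pow_prime (G := Q.comap f) p (n := m) (by
      rw [Subgroup.card_comap_of_surjective hfs, hQ, hFp]
      exact dvd_mul_left _ _)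
    exact ⟨P.map (Q.comap f).subtype, Subgroup.map_subtype_le P, by
      rw [← hP]
      exact Nat.card_congr (P.equivMapOfInjective _ (Subgroup.subtype_injective _)).symm.toEquiv⟩
  -- A `p`-group acting on a set of size divisible by `p` and fixing 0 fixes another point.
  obtain ⟨u, hu, hu0⟩ := (IsPGroup.of_card hPcard).exists_fixed_point_of_prime_dvd_card_of_fixed_point
    (Fin 2 → F) (by
      rw [Nat.card_fun]
      exact dvd_pow hpF (by simp)) (a := 0) (fun g => smul_zero g)
  refine ⟨u, hu0.symm, ?_⟩
  have hPs : P = MulAction.stabilizer (SpecialLinearGroup (Fin 2) F) u := by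
    refine Subgroup.eq_of_le_of_card_ge (fun g hg => hu ⟨g, hg⟩) ?_
    rw [hPcard, ← hFp]
    exact card_stabilizer_le hu0.symm
  -- A central element is ±1 and fixes `u` only if it is 1, so `f` is injective on `P` and the
  -- orders agree.
  have hmap : P.map f = Q := by
    refine Subgroup.eq_of_le_of_card_ge (Subgroup.map_le_iff_le_comap.2 hPQ) ?_
    rw [← Subgroup.relIndex_ker, Subgroup.relIndex, (Subgroup.subgroupOf_eq_bot).2,
      Subgroup.index_bot, hPcard, hQ, hFp]
    rw [Subgroup.disjoint_def]
    intro g hg hgP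
    obtain ⟨r, hr, hrg⟩ := exists_smul_eq_of_mem_center (hker ▸ hg)
    have hgu : g • u = u := hu ⟨g, hgP⟩
    rw [hrg] at hgu
    have hr1 : r = 1 := by
      have : (r - 1) • u = 0 := by rw [sub_smul, hgu, one_smul, sub_self]
      exact sub_eq_zero.1 ((smul_eq_zero.1 this).resolve_right hu0.symm)
    obtain ⟨w, hw⟩ := exists_wedge_eq hu0.symm 1
    refine sl_eq_of_smul_eq (s := u) (t := w) (by rw [hw]; exact one_ne_zero) ?_ ?_ <;>
      rw [hrg, hr1, one_smul, one_smul]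
  have hQu : ∀ x, f x ∈ Q → x • u = u ∨ x • u = -u := by
    intro x hx
    rw [← hmap] at hx
    obtain ⟨g, hg, hgx⟩ := hx
    have hc : g⁻¹ * x ∈ f.ker := by
      rw [MonoidHom.mem_ker, map_mul, map_inv, hgx, inv_mul_cancel]
    obtain ⟨r, hr, hrg⟩ := exists_smul_eq_of_mem_center (hker ▸ hc)
    have hgu : g • u = u := hu ⟨g, hg⟩
    have hxu : x • u = r • u := by
      rw [← mul_inv_cancel_left g x, mul_smul, hrg, smul_comm, hgu]
    rcases hr with rfl | rfl
    · left; simpa using hxu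
    · right; simpa using hxu
  -- Conjugating the transvection `t` along `u` by `h` gives an element over `Q`, which sends `u` to
  -- `±u`. Hence `t` sends `h • u` to `±(h • u)`; as `2 ≠ 0`, either sign forces `h • u` to be
  -- parallel to `u`.
  have hpar : ∀ h : H.comap f, ∃ a : Fˣ, h.1 • u = (a : F) • u := by
    rintro ⟨h, hh⟩
    obtain ⟨t, ht⟩ := exists_transvection u
    have htP : t ∈ P := by
      rw [hPs, MulAction.mem_stabilizer_iff, ht, wedge_self, zero_smul, add_zero]
    have hx : f (h⁻¹ * t * h) ∈ Q := by
      have := hn (f h)⁻¹ (H.inv_mem hh) (f t) (hPQ htP)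
      simpa using this
    have e : h • (h⁻¹ * t * h) • u = h • u + wedge u (h • u) • u := by
      rw [← mul_smul, ← ht (h • u), ← mul_smul]
      congr 1
      group
    have hw : wedge u (h • u) = 0 := by
      rcases hQu _ hx with h1 | h1
      · rw [h1] at e
        have := left_eq_add.1 e
        exact (smul_eq_zero.1 this).resolve_right hu0.symm
      · rw [h1, smul_neg] at e
        have e2 : (2 : F) • (h • u) = (-wedge u (h • u)) • u := by
          rw [two_smul, neg_smul, ← add_eq_zero_iff_eq_neg, add_assoc, ← e, add_neg_cancel]
        have e3 := congrArg (wedge u) e2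
        rw [wedge_smul_right, wedge_smul_right, wedge_self, mul_zero] at e3
        exact (mul_eq_zero.1 e3).resolve_left h2
    obtain ⟨a, ha⟩ := exists_eq_smul_of_wedge_eq_zero hu0.symm hw
    have ha0 : a ≠ 0 := by
      rintro rfl
      rw [zero_smul, smul_eq_zero_iff_eq] at ha
      exact hu0 ha.symm
    exact ⟨Units.mk0 a ha0, ha⟩
  have hinj : ∀ a b : Fˣ, (a : F) • u = (b : F) • u → a = b := by
    intro a b hab
    refine Units.ext (sub_eq_zero.1 ?_)
    have : ((a : F) - b) • u = 0 := by rw [sub_smul, hab, sub_self]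
    exact (smul_eq_zero.1 this).resolve_right hu0.symm
  choose χ hχ using hpar
  let X : H.comap f →* Fˣ := MonoidHom.mk' χ (fun g h => hinj _ _ (by
    rw [← hχ, Units.val_mul, mul_smul, ← hχ, Subgroup.coe_mul, mul_smul, hχ h, smul_comm, hχ g,
      smul_comm]))
  have hPH : P ≤ H.comap f := hPQ.trans (Subgroup.comap_mono hQH)
  have hXker : X.ker = P.subgroupOf (H.comap f) := by
    ext g
    rw [MonoidHom.mem_ker, Subgroup.mem_subgroupOf, hPs, MulAction.mem_stabilizer_iff]
    constructor
    · intro h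
      have := hχ g
      rw [show χ g = 1 from h] at this
      simpa using this
    · intro h
      refine hinj _ _ ?_
      change (χ g : F) • u = _
      rw [← hχ g, h]; simp
  refine ⟨X.range, ?_, ?_, ?_⟩
  -- The preimage of `H` has order `2 * |F| * n` and the eigenvalue character has kernel `P` of
  -- order `|F|`, leaving `2 * n` eigenvalues.
  · have h1 := X.ker.card_mul_index
    rw [Subgroup.index_ker, hXker, Nat.card_congr (Subgroup.subgroupOfEquivOfLe hPH).toEquiv,
      hPcard, Subgroup.card_comap_of_surjective hfs, hker, card_center_sl_two p hp2, hcard,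
      ← hFp] at h1
    refine Nat.eq_of_mul_eq_mul_left hkpos (h1.trans ?_)
    ring
  · have hm : (-1 : SpecialLinearGroup (Fin 2) F) ∈ H.comap f := by
      have : (-1 : SpecialLinearGroup (Fin 2) F) ∈ f.ker := by
        rw [hker, Subgroup.mem_center_iff]
        intro g; simp
      rw [Subgroup.mem_comap, this]
      exact H.one_mem
    refine ⟨⟨-1, hm⟩, hinj _ _ ?_⟩
    change (χ _ : F) • u = _
    rw [← hχ]
    ext i
    rw [sl_smul_apply]
    fin_cases i <;> simp
  · intro g
    constructor
    · intro hg
      exact ⟨χ ⟨g, hg⟩, ⟨⟨g, hg⟩, rfl⟩, hχ ⟨g, hg⟩⟩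
    · rintro ⟨_, ⟨h, rfl⟩, hg⟩
      have hgP : h.1⁻¹ * g ∈ P := by
        rw [hPs, MulAction.mem_stabilizer_iff, mul_smul, hg, inv_smul_eq_iff]
        exact (hχ h).symm
      have := (H.comap f).mul_mem h.2 (hPH hgP)
      rwa [mul_inv_cancel_left] at this

/-! ### Representing cosets by vectors -/

/-- The coset of `f g` is represented by `g • u`, well defined up to `C`. The last clause says that
the action on cosets is the action on vectors modulo `C`; with `g = 1` it gives injectivity. -/
theorem exists_vector_representatives {F : Type*} [Field F]
    (H : Subgroup (Matrix.ProjectiveSpecialLinearGroup (Fin 2) F)) {u : Fin 2 → F} (hu : u ≠ 0)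
    (C : Subgroup Fˣ)
    (hH : ∀ g : SpecialLinearGroup (Fin 2) F,
      QuotientGroup.mk' (Subgroup.center (SpecialLinearGroup (Fin 2) F)) g ∈ H ↔
        ∃ a ∈ C, g • u = (a : F) • u) :
    ∃ r : Matrix.ProjectiveSpecialLinearGroup (Fin 2) F ⧸ H → Fin 2 → F,
      (∀ x, r x ≠ 0) ∧ (∀ v, v ≠ 0 → ∃ x, ∃ a ∈ C, v = (a : F) • r x) ∧
      ∀ (g : SpecialLinearGroup (Fin 2) F) x y, ∀ a ∈ C, g • r x = (a : F) • r y →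
        QuotientGroup.mk' (Subgroup.center (SpecialLinearGroup (Fin 2) F)) g • x = y := by
  set f := QuotientGroup.mk' (Subgroup.center (SpecialLinearGroup (Fin 2) F)) with hf
  have hfs : Function.Surjective f := QuotientGroup.mk'_surjective _
  have hlift : ∀ x : Matrix.ProjectiveSpecialLinearGroup (Fin 2) F ⧸ H,
      ∃ g : SpecialLinearGroup (Fin 2) F, QuotientGroup.mk (f g) = x := by
    intro x
    obtain ⟨y, rfl⟩ := QuotientGroup.mk_surjective x
    obtain ⟨g, rfl⟩ := hfs y
    exact ⟨g, rfl⟩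
  choose γ hγ using hlift
  refine ⟨fun x => γ x • u, fun x => ?_, fun v hv => ?_, fun g x y a ha h => ?_⟩
  · exact (smul_ne_zero_iff_ne (γ x)).2 hu
  · obtain ⟨w, hw⟩ := exists_wedge_eq hu 1
    obtain ⟨w', hw'⟩ := exists_wedge_eq hv 1
    obtain ⟨g, hg, -⟩ := exists_sl_smul_eq (u := u) (v := w) (u' := v) (v' := w')
      (by rw [hw]; exact one_ne_zero) (by rw [hw, hw'])
    refine ⟨QuotientGroup.mk (f g), ?_⟩
    have h1 : f ((γ (QuotientGroup.mk (f g)))⁻¹ * g) ∈ H := by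
      rw [map_mul, map_inv]
      exact QuotientGroup.eq.1 (hγ _)
    obtain ⟨a, ha, hau⟩ := (hH _).1 h1
    refine ⟨a, ha, ?_⟩
    rw [mul_smul, inv_smul_eq_iff, hg] at hau
    rw [hau, smul_comm]
  · have h1 : f ((γ y)⁻¹ * (g * γ x)) ∈ H := by
      refine (hH _).2 ⟨a, ha, ?_⟩
      rw [mul_smul, mul_smul, h, smul_comm, inv_smul_smul]
    rw [map_mul, map_inv] at h1
    have h2 := QuotientGroup.eq.2 h1
    rw [hγ, map_mul] at h2
    rw [h2]
    conv_lhs => rw [← hγ x]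
    rfl

/-! ### Counting vectors -/

section Count

variable {F : Type*} [Field F]

/-- Determinants against two independent vectors are coordinates on the plane. -/
theorem card_wedge_mem [Finite F] {s t : Fin 2 → F} (hst : wedge s t ≠ 0) (A B : Set F) :
    Nat.card {v : Fin 2 → F // wedge s v ∈ A ∧ wedge t v ∈ B} = Nat.card A * Nat.card B := by
  have hinj : Function.Injective fun v : Fin 2 → F => (wedge s v, wedge t v) := by
    intro v v' h
    exact eq_of_wedge_eq hst (Prod.ext_iff.1 h).1 (Prod.ext_iff.1 h).2
  have hbij := hinj.bijective_of_nat_card_le (by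
    rw [Nat.card_prod, Nat.card_fun, Nat.card_fin, sq])
  rw [← Nat.card_prod, ← Nat.card_congr (Equiv.Set.prod A B)]
  exact Nat.card_congr ((Equiv.ofBijective _ hbij).subtypeEquiv fun v => by simp)

variable {V : Type*} {r : V → Fin 2 → F} {C : Subgroup Fˣ}

/-- `C` acts freely on nonzero vectors and `r` picks one vector from each orbit, so counting
vertices is counting vectors and dividing by `|C|`. -/
theorem card_subtype_comp_mul (hr0 : ∀ x, r x ≠ 0)
    (hsurj : ∀ v, v ≠ 0 → ∃ x, ∃ a ∈ C, v = (a : F) • r x)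
    (hinj : ∀ x y, ∀ a ∈ C, r x = (a : F) • r y → x = y) (p : (Fin 2 → F) → Prop)
    (hp0 : ∀ v, p v → v ≠ 0) (hpC : ∀ v, ∀ a ∈ C, p ((a : F) • v) ↔ p v) :
    Nat.card C * Nat.card {x // p (r x)} = Nat.card {v // p v} := by
  rw [← Nat.card_prod]
  refine Nat.card_congr (Equiv.ofBijective
    (fun z : C × {x // p (r x)} => ⟨((z.1 : Fˣ) : F) • r z.2.1, (hpC _ _ z.1.2).2 z.2.2⟩) ⟨?_, ?_⟩)
  · rintro ⟨⟨a, ha⟩, ⟨x, hx⟩⟩ ⟨⟨b, hb⟩, ⟨y, hy⟩⟩ h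
    have h : (a : F) • r x = (b : F) • r y := congrArg Subtype.val h
    have hxy : x = y := by
      refine hinj x y (a⁻¹ * b) (C.mul_mem (C.inv_mem ha) hb) ?_
      rw [Units.val_mul, mul_smul, ← h, smul_smul, Units.inv_mul, one_smul]
    subst hxy
    have hab : ((a : F) - b) • r x = 0 := by rw [sub_smul, h, sub_self]
    have : a = b := Units.ext (sub_eq_zero.1 ((smul_eq_zero.1 hab).resolve_right (hr0 x)))
    subst this
    rfl
  · rintro ⟨v, hv⟩
    obtain ⟨x, a, ha, rfl⟩ := hsurj v (hp0 v hv)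
    exact ⟨⟨⟨a, ha⟩, ⟨x, (hpC _ _ ha).1 hv⟩⟩, rfl⟩

/-- The graph on representing vectors in which `x` and `y` are adjacent when the determinant of
their vectors lies in the coset `δ C`. -/
def wedgeGraph (r : V → Fin 2 → F) (C : Subgroup Fˣ) (hC : -1 ∈ C) (δ : Fˣ) : SimpleGraph V where
  Adj x y := ∃ a ∈ C, wedge (r x) (r y) = δ * (a : F)
  symm := ⟨by
    rintro x y ⟨a, ha, h⟩
    refine ⟨-1 * a, C.mul_mem hC ha, ?_⟩
    rw [wedge_swap, h]; simp⟩
  loopless := ⟨by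
    rintro x ⟨a, ha, h⟩
    rw [wedge_self] at h
    exact mul_ne_zero δ.ne_zero a.ne_zero h.symm⟩

theorem wedgeGraph_exists_isCyclicList [Finite F] [Finite V] (hr0 : ∀ x, r x ≠ 0)
    (hsurj : ∀ v, v ≠ 0 → ∃ x, ∃ a ∈ C, v = (a : F) • r x)
    (hinj : ∀ x y, ∀ a ∈ C, r x = (a : F) • r y → x = y) (hC : -1 ∈ C) (δ : Fˣ) {c : ℕ}
    (hc : 4 ≤ c) (hCc : Nat.card C = c) (hF : Nat.card F = 3 * c + 1) :
    Nat.card V = 9 * c + 6 ∧ ∃ l, (wedgeGraph r C hC δ).IsCyclicList l ∧ ∀ v, v ∈ l := by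
  classical
  let _ := Fintype.ofFinite V
  have hc0 : 0 < c := by omega
  let T : Set F := {z | ∃ a ∈ C, z = δ * (a : F)}
  have hTC : ∀ z, ∀ a ∈ C, (a : F) * z ∈ T ↔ z ∈ T := by
    intro z a ha
    constructor
    · rintro ⟨b, hb, h⟩
      refine ⟨a⁻¹ * b, C.mul_mem (C.inv_mem ha) hb, ?_⟩
      rw [Units.val_mul, mul_left_comm, ← h, ← mul_assoc, Units.inv_mul, one_mul]
    · rintro ⟨b, hb, rfl⟩
      exact ⟨a * b, C.mul_mem ha hb, by rw [Units.val_mul]; ring⟩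
  have hT0 : (0 : F) ∉ T := by
    rintro ⟨a, -, h⟩
    exact mul_ne_zero δ.ne_zero a.ne_zero h.symm
  have hT : Nat.card T = c := by
    rw [← hCc]
    refine (Nat.card_congr (Equiv.ofBijective
      (fun a : C => (⟨δ * ((a : Fˣ) : F), a, a.2, rfl⟩ : T)) ⟨?_, ?_⟩)).symm
    · intro a b h
      have h := congrArg Subtype.val h
      exact Subtype.ext (Units.ext (mul_left_cancel₀ δ.ne_zero h))
    · rintro ⟨z, a, ha, rfl⟩
      exact ⟨⟨a, ha⟩, rfl⟩
  have hadj : ∀ x y, (wedgeGraph r C hC δ).Adj x y ↔ wedge (r y) (r x) ∈ T := fun x y =>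
    (wedgeGraph r C hC δ).adj_comm x y
  have hV : Nat.card V = 9 * c + 6 := by
    have h1 := card_subtype_comp_mul hr0 hsurj hinj (fun v => v ≠ 0) (fun _ h => h)
      (fun v a _ => by simp)
    rw [hCc, Nat.card_congr (Equiv.subtypeUnivEquiv hr0)] at h1
    have h2 : Nat.card {v : Fin 2 → F // v ≠ 0} + 1 = (3 * c + 1) ^ 2 := by
      have h3 : Nat.card (Fin 2 → F) = (3 * c + 1) ^ 2 := by
        rw [Nat.card_fun, Nat.card_fin, hF]
      let _ := Fintype.ofFinite F
      rw [← h3, Nat.card_eq_fintype_card, Nat.card_eq_fintype_card,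
        Fintype.card_subtype_compl, Fintype.card_subtype_eq]
      exact Nat.sub_add_cancel Fintype.card_pos
    refine Nat.eq_of_mul_eq_mul_left hc0 (Nat.succ_injective ?_)
    change _ + 1 = _ + 1
    rw [h1, h2]; ring
  have hne : Nonempty V := by
    refine (Nat.card_pos_iff.1 ?_).1
    omega
  refine ⟨hV, SimpleGraph.exists_isCyclicList_forall_mem _ hc
    (Nat.card_eq_fintype_card.symm.trans hV) ?_ ?_⟩
  · intro s
    obtain ⟨t, ht⟩ := exists_wedge_eq (hr0 s) 1
    have h1 := card_subtype_comp_mul hr0 hsurj hinj (fun v => wedge (r s) v ∈ T)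
      (fun v hv h0 => by subst h0; simp [wedge] at hv; exact hT0 hv)
      (fun v a ha => by rw [wedge_smul_right]; exact hTC _ a ha)
    have h2 := card_wedge_mem (s := r s) (t := t) (by rw [ht]; exact one_ne_zero) T Set.univ
    simp only [Set.mem_univ, and_true] at h2
    rw [h2, hCc, hT, Nat.card_univ, hF] at h1
    rw [← Nat.eq_of_mul_eq_mul_left hc0 h1, Nat.card_eq_fintype_card, Fintype.card_subtype]
    simp only [hadj]
  · intro s t hst
    simp only [hadj]
    -- For `r t = b • r s`, a common neighbour would put `b` in `C` and give `s = t`. Otherwise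
    -- there are `c * c` vectors, hence `c` vertices.
    by_cases hw : wedge (r s) (r t) = 0
    · obtain ⟨b, hb⟩ := exists_eq_smul_of_wedge_eq_zero (hr0 s) hw
      rw [Finset.filter_false_of_mem]
      · simp
      rintro w - ⟨⟨a, ha, h1⟩, ⟨a', ha', h2⟩⟩
      rw [hb, wedge_smul_left, h1] at h2
      have hba : b * a = a' := mul_left_cancel₀ δ.ne_zero (by rw [← h2]; ring)
      refine hst (hinj t s (a' * a⁻¹) (C.mul_mem ha' (C.inv_mem ha)) ?_).symm
      rw [hb, Units.val_mul, ← hba, mul_assoc, Units.mul_inv, mul_one]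
    · have h1 := card_subtype_comp_mul hr0 hsurj hinj
        (fun v => wedge (r s) v ∈ T ∧ wedge (r t) v ∈ T)
        (fun v hv h0 => by subst h0; simp [wedge] at hv; exact hT0 hv)
        (fun v a ha => by
          rw [wedge_smul_right, wedge_smul_right]; exact and_congr (hTC _ a ha) (hTC _ a ha))
      rw [card_wedge_mem hw, hCc, hT] at h1
      rw [← Fintype.card_subtype, ← Nat.card_eq_fintype_card, Nat.eq_of_mul_eq_mul_left hc0 h1]

end Count

/-! ### Generalized orbital graphs -/

theorem IsGeneralizedOrbitalGraph.adj_smul {G V : Type*} [Group G] [MulAction G V]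
    {X : SimpleGraph V} (hX : IsGeneralizedOrbitalGraph G X) (g : G) {x y : V} (h : X.Adj x y) :
    X.Adj (g • x) (g • y) := by
  obtain ⟨S, hS, hX⟩ := hX
  obtain ⟨O, hO, hxy⟩ := (hX x y).1 h
  refine (hX _ _).2 ⟨O, hO, ?_⟩
  obtain ⟨u, v, rfl⟩ := hS hO
  exact MulAction.mem_orbit_of_mem_orbit g hxy

/-- A connected graph on representing vectors has an edge between non-parallel vectors. -/
theorem exists_adj_wedge_ne_zero {F : Type*} [Field F] {V : Type*} {X : SimpleGraph V}
    (hX : X.Connected) {r : V → Fin 2 → F} {C : Subgroup Fˣ} (hr0 : ∀ x, r x ≠ 0)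
    (hsurj : ∀ v, v ≠ 0 → ∃ x, ∃ a ∈ C, v = (a : F) • r x) :
    ∃ x y, X.Adj x y ∧ wedge (r x) (r y) ≠ 0 := by
  by_contra! hcon
  have hwalk : ∀ x y, X.Reachable x y → wedge (r x) (r y) = 0 := by
    rintro x y ⟨p⟩
    induction p with
    | nil => exact wedge_self _
    | @cons x z y h p ih =>
      obtain ⟨a, ha⟩ := exists_eq_smul_of_wedge_eq_zero (hr0 x) (hcon _ _ h)
      rw [ha, wedge_smul_left] at ih
      refine (mul_eq_zero.1 ih).resolve_left ?_
      rintro rfl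
      exact hr0 z (by rw [ha, zero_smul])
  obtain ⟨x⟩ := hX.nonempty
  obtain ⟨w, hw⟩ := exists_wedge_eq (hr0 x) 1
  have hw0 : w ≠ 0 := by
    rintro rfl
    simp [wedge] at hw
  obtain ⟨y, a, -, rfl⟩ := hsurj w hw0
  rw [wedge_smul_right, hwalk x y (hX.preconnected x y), mul_zero] at hw
  exact zero_ne_one hw

/-! ### Arithmetic of `k` and the conclusion -/

theorem exists_eq_six_mul_add_one {p k : ℕ} (hp : p.Prime) (hk : k + 1 = 2 * p)
    (h3 : 3 ∣ (k - 1) / 2) : ∃ n, 2 ≤ n ∧ k = 6 * n + 1 ∧ (k - 1) / 6 = n := by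
  obtain ⟨n, hn⟩ := h3
  have hp2 := hp.two_le
  have hp1 : p = 3 * n + 1 := by omega
  -- `n = 1` would give `p = 4`; excluding it yields `4 ≤ c` for `c = 2 * n`.
  have hn1 : n ≠ 1 := by
    rintro rfl
    rw [hp1] at hp
    norm_num at hp
  exact ⟨n, by omega, by omega, by omega⟩

theorem mainTheorem4 (p k : ℕ) (hp : p.Prime) (hk : k + 1 = 2 * p) (h3 : 3 ∣ (k - 1) / 2)
    {F : Type*} [Field F] [Finite F] (hF : Nat.card F = k)
    (H : Subgroup (Matrix.ProjectiveSpecialLinearGroup (Fin 2) F))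
    (hH : IsAddSemidirectCyclic F ((k - 1) / 6) H)
    [DecidableEq (Matrix.ProjectiveSpecialLinearGroup (Fin 2) F ⧸ H)]
    (X : SimpleGraph (Matrix.ProjectiveSpecialLinearGroup (Fin 2) F ⧸ H))
    (hX : IsGeneralizedOrbitalGraph (Matrix.ProjectiveSpecialLinearGroup (Fin 2) F) X)
    (hconn : X.Connected) :
    ∃ (x : Matrix.ProjectiveSpecialLinearGroup (Fin 2) F ⧸ H) (c : X.Walk x x),
      c.IsHamiltonianCycle := by
  obtain ⟨n, hn2, hkn, hn⟩ := exists_eq_six_mul_add_one hp hk h3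
  rw [hn] at hH
  obtain ⟨hcard, Q, hQH, hQ, hnorm⟩ := hH.exists_normal
  obtain ⟨u, hu, C, hCc, hC, hHC⟩ :=
    exists_eigenvector_of_normal (by omega) H hcard Q hQH hQ hnorm
  obtain ⟨r, hr0, hsurj, hsmul⟩ := exists_vector_representatives H hu C hHC
  have hinj : ∀ x y, ∀ a ∈ C, r x = (a : F) • r y → x = y := by
    intro x y a ha h
    have := hsmul 1 x y a ha (by rwa [one_smul])
    rwa [map_one, one_smul] at this
  obtain ⟨x, y, hxy, hw⟩ := exists_adj_wedge_ne_zero hconn hr0 hsurj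
  obtain ⟨hV, l, hl, hall⟩ := wedgeGraph_exists_isCyclicList hr0 hsurj hinj hC (Units.mk0 _ hw)
    (c := 2 * n) (by omega) hCc (by omega)
  have hle : wedgeGraph r C hC (Units.mk0 _ hw) ≤ X := by
    rintro x' y' ⟨a, ha, h⟩
    rw [Units.val_mk0] at h
    -- Rescaling `r y'` by `a⁻¹` makes the determinant exactly that of the known edge without
    -- changing the vertex.
    obtain ⟨g, hg1, hg2⟩ := exists_sl_smul_eq (u := r x) (v := r y) (u' := r x')
      (v' := ((a⁻¹ : Fˣ) : F) • r y') hw (by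
        rw [wedge_smul_right, h, mul_left_comm, Units.inv_mul, mul_one])
    have := hX.adj_smul (QuotientGroup.mk' _ g) hxy
    rwa [hsmul g x x' 1 C.one_mem (by rw [hg1]; simp), hsmul g y y' a⁻¹ (C.inv_mem ha) hg2] at this
  have hlen : Nat.card (Matrix.ProjectiveSpecialLinearGroup (Fin 2) F ⧸ H) ≤ l.length := by
    let _ := Fintype.ofFinite (Matrix.ProjectiveSpecialLinearGroup (Fin 2) F ⧸ H)
    rw [Nat.card_eq_fintype_card, ← Finset.card_univ,
      ← (Finset.eq_univ_iff_forall (s := l.toFinset)).2 fun v => List.mem_toFinset.2 (hall v)]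
    exact List.toFinset_card_le l
  exact (hl.mono hle).exists_isHamiltonianCycle (by omega) hall
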